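/- For $\beta\in(1,2)$, a $\beta$-expansion of a real number $x$ is a sequence $(a_1,a_2,\dots)\in\{0,1\}^{\mathbb N}$ with $x=\sum_{k\ge1}a_k\beta^{-k}$. Let $I_\beta=[0,\frac1{\beta-1}]$, and for $x\in I_\beta$ let $\mathcal E_n(x;\beta)\subseteq\{0,1\}^n$ be the set of words of length $n$ that are prefixes of $\beta$-expansions of $x$. The maximal growth exponent of $\beta$ is $$\mathfrak M_\beta=\sup_{x\in I_\beta}\ \limsup_{n\to\infty}\sqrt[n]{\#\mathcal E_n(x;\beta)}.$$ For an integer $m\ge2$ let $\tau_m$ be the $m$-th multinacci number, that is, the positive (equivalently, the largest) real root of $x^m=x^{m-1}+x^{m-2}+\dots+x+1$, and let $\tau=\tau_2=\frac{1+\sqrt5}2$. Then $$\mathfrak M_{\tau_m}=\begin{cases}\sqrt\tau,&m=2,\\ 2^{1/(m+1)},&m\ge3.\end{cases}$$ -/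

import Mathlib

open Filter Topology

/-- `a = (a₁, a₂, …) ∈ {0,1}^ℕ` (with `a_{k+1}` stored at index `k`) is a `β`-expansion of `x`:
`x = ∑_{k ≥ 1} a_k β^{-k}`. -/
def IsBetaExpansion (β x : ℝ) (a : ℕ → Fin 2) : Prop :=
  HasSum (fun k : ℕ => ((a k : ℕ) : ℝ) * (β ^ (k + 1))⁻¹) x

/-- The set of `0`-`1` words of length `n` that are prefixes of `β`-expansions of `x`. -/
def prefixSet (β x : ℝ) (n : ℕ) : Set (Fin n → Fin 2) :=
  {w | ∃ a : ℕ → Fin 2, IsBetaExpansion β x a ∧ ∀ i : Fin n, a i = w i}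

/-- The (upper) exponential growth rate `limsup_n (#prefixSet)^{1/n}` at the point `x`. -/
noncomputable def growthExponent (β x : ℝ) : ℝ :=
  limsup (fun n : ℕ => ((prefixSet β x n).ncard : ℝ) ^ (1 / (n : ℝ))) atTop

/-- The maximal growth exponent: the supremum of the growth rates over `x ∈ [0, 1/(β-1)]`. -/
noncomputable def maximalGrowthExponent (β : ℝ) : ℝ :=
  ⨆ x : Set.Icc (0 : ℝ) (1 / (β - 1)), growthExponent β x

/-- The `m`-th multinacci number: the largest real root of
`x^m = x^{m-1} + x^{m-2} + ⋯ + x + 1`. -/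
noncomputable def multinacci (m : ℕ) : ℝ :=
  sSup {x : ℝ | x ^ m = ∑ i ∈ Finset.range m, x ^ i}

/-! The facts below show that the `limsup`, the suprema and the root above are genuine. -/

theorem prefixSet_rpow_mem_Icc (β x : ℝ) (n : ℕ) :
    ((prefixSet β x n).ncard : ℝ) ^ (1 / (n : ℝ)) ∈ Set.Icc (0 : ℝ) 2 := by
  refine ⟨by positivity, ?_⟩
  rcases Nat.eq_zero_or_pos n with rfl | hn
  · simp
  · have h : (prefixSet β x n).ncard ≤ 2 ^ n := by
      have := Set.ncard_le_card (prefixSet β x n)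
      simpa using this
    have h' : ((prefixSet β x n).ncard : ℝ) ≤ 2 ^ n := by exact_mod_cast h
    calc ((prefixSet β x n).ncard : ℝ) ^ (1 / (n : ℝ))
        ≤ ((2 : ℝ) ^ n) ^ (1 / (n : ℝ)) :=
          Real.rpow_le_rpow (by positivity) h' (by positivity)
      _ = 2 := by
          rw [one_div]
          exact Real.pow_rpow_inv_natCast (by norm_num) hn.ne'

theorem prefixSet_isBoundedUnder (β x : ℝ) :
    IsBoundedUnder (· ≤ ·) atTop
      (fun n : ℕ => ((prefixSet β x n).ncard : ℝ) ^ (1 / (n : ℝ))) :=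
  isBoundedUnder_of ⟨2, fun n => (prefixSet_rpow_mem_Icc β x n).2⟩

theorem prefixSet_isCoboundedUnder (β x : ℝ) :
    IsCoboundedUnder (· ≤ ·) atTop
      (fun n : ℕ => ((prefixSet β x n).ncard : ℝ) ^ (1 / (n : ℝ))) :=
  IsBoundedUnder.isCoboundedUnder_le
    (isBoundedUnder_of ⟨0, fun n => (prefixSet_rpow_mem_Icc β x n).1⟩)

theorem bddAbove_growthExponent (β : ℝ) :
    BddAbove (Set.range fun x : Set.Icc (0 : ℝ) (1 / (β - 1)) => growthExponent β x) := by
  refine ⟨2, ?_⟩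
  rintro _ ⟨x, rfl⟩
  exact limsup_le_of_le (prefixSet_isCoboundedUnder β x)
    (Eventually.of_forall fun n => (prefixSet_rpow_mem_Icc β x n).2)

theorem existsUnique_multinacci {m : ℕ} (hm : 2 ≤ m) :
    ∃! x : ℝ, 0 < x ∧ x ^ m = ∑ i ∈ Finset.range m, x ^ i := by
  have hinj : ∀ x y : ℝ, 0 < x → x < y → x ^ m = ∑ i ∈ Finset.range m, x ^ i →
      y ^ m = ∑ i ∈ Finset.range m, y ^ i → False := by
    intro x y hx hxy h1 h2
    have hy := hx.trans hxy
    have hlt : ∑ i ∈ Finset.range m, x ^ m * y ^ i < ∑ i ∈ Finset.range m, y ^ m * x ^ i := by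
      refine Finset.sum_lt_sum_of_nonempty ⟨0, by simp; omega⟩ fun i hi => ?_
      have hi' : i < m := Finset.mem_range.1 hi
      obtain ⟨k, rfl⟩ := Nat.exists_eq_add_of_lt hi'
      have : x ^ (k + 1) < y ^ (k + 1) := pow_lt_pow_left₀ hxy hx.le (by omega)
      have h0 : 0 < x ^ i * y ^ i := by positivity
      have := mul_lt_mul_of_pos_left this h0
      calc x ^ (i + k + 1) * y ^ i = x ^ i * y ^ i * x ^ (k + 1) := by ring
        _ < x ^ i * y ^ i * y ^ (k + 1) := this
        _ = y ^ (i + k + 1) * x ^ i := by ring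
    rw [← Finset.mul_sum, ← Finset.mul_sum, ← h1, ← h2, mul_comm] at hlt
    exact lt_irrefl _ hlt
  have hcont : ContinuousOn (fun x : ℝ => x ^ m - ∑ i ∈ Finset.range m, x ^ i) (Set.Icc 1 2) := by
    fun_prop
  have hgeom : (∑ i ∈ Finset.range m, (2 : ℝ) ^ i) = 2 ^ m - 1 := by
    rw [geom_sum_eq (by norm_num)]; norm_num
  have hm' : (2 : ℝ) ≤ m := by exact_mod_cast hm
  obtain ⟨x, hx, hx0⟩ := intermediate_value_Icc (by norm_num : (1 : ℝ) ≤ 2) hcont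
    (show (0 : ℝ) ∈ _ by
      constructor
      · simp; linarith
      · simp only [hgeom]; linarith)
  have hx1 : 0 < x := by linarith [hx.1]
  have hx2 : x ^ m = ∑ i ∈ Finset.range m, x ^ i := sub_eq_zero.1 hx0
  refine ⟨x, ⟨hx1, hx2⟩, ?_⟩
  rintro y ⟨hy1, hy2⟩
  rcases lt_trichotomy y x with h | h | h
  · exact (hinj y x hy1 h hy2 hx2).elim
  · exact h
  · exact (hinj x y hx1 h hx2 hy2).elim

theorem multinacci_isGreatest {m : ℕ} (hm : 2 ≤ m) :
    IsGreatest {x : ℝ | x ^ m = ∑ i ∈ Finset.range m, x ^ i} (multinacci m) := by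
  obtain ⟨x, ⟨hx1, hx2⟩, hu⟩ := existsUnique_multinacci hm
  have h : IsGreatest {x : ℝ | x ^ m = ∑ i ∈ Finset.range m, x ^ i} x := by
    refine ⟨hx2, fun y hy => ?_⟩
    rcases le_or_gt y 0 with h | h
    · exact h.trans hx1.le
    · exact (hu y ⟨h, hy⟩).le
  have : multinacci m = x := h.csSup_eq
  rwa [this]

/-! Prefix counts satisfy `N (n+1) x = N n (βx) + N n (βx - 1)`.

Upper bound (`interiorCount_le`): branching creates two points at distance `1 = β⁻¹ + ⋯ + β⁻ᵐ`.
While both stay interior, digits are forced and the distance drops one term at a time; from distance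
`β⁻¹`, the two middle children coincide. So multiplicities `(a, b)` become, every `m` steps, `(a, a
+ b)` or `(a + b, b)`, or collapse to a single point. The first two grow by at most the golden ratio
`τ` per `m` steps; splitting and collapsing gives a factor 2 per `m + 1` steps. Hence the rate is at
most any `λ` (with `1 < λ ≤ 2`) such that `τ ≤ λ^m` and `2 ≤ λ^(m+1)`. The first condition is
binding for `m = 2`, the second for `m ≥ 3`.

Lower bound: the interchangeable words `10ᵐ` and `01ᵐ` give doubling; for `m = 2` two points feed
each other through the matrix `[[2, 1], [1, 1]]`, whose top eigenvalue is `τ²`, every 4 steps. -/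

/-! ### Expansions and the recursion for prefix counts -/

theorem isBetaExpansion_iff_shift {β : ℝ} (hβ : 1 < β) (x : ℝ) (a : ℕ → Fin 2) :
    IsBetaExpansion β x a ↔
      IsBetaExpansion β (β * x - ((a 0 : ℕ) : ℝ)) (fun k => a (k + 1)) := by
  have hβ0 : β ≠ 0 := by positivity
  unfold IsBetaExpansion
  rw [← hasSum_nat_add_iff' 1, ← hasSum_mul_left_iff hβ0]
  have h1 : β * (x - ∑ i ∈ Finset.range 1, ((a i : ℕ) : ℝ) * (β ^ (i + 1))⁻¹)
      = β * x - ((a 0 : ℕ) : ℝ) := by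
    simp
    field_simp
  have h2 : (fun k : ℕ => β * (((a (k + 1) : ℕ) : ℝ) * (β ^ (k + 1 + 1))⁻¹))
      = fun k : ℕ => ((a (k + 1) : ℕ) : ℝ) * (β ^ (k + 1))⁻¹ := by
    funext k
    rw [pow_succ β (k + 1)]
    field_simp
  rw [h1, h2]

theorem hasSum_inv_pow_succ {β : ℝ} (hβ : 1 < β) :
    HasSum (fun k : ℕ => (β ^ (k + 1))⁻¹) (1 / (β - 1)) := by
  have h := (hasSum_geometric_of_lt_one (r := β⁻¹) (by positivity)
    (inv_lt_one_of_one_lt₀ hβ)).mul_left β⁻¹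
  have h0 : β ≠ 0 := by positivity
  have h1 : β - 1 ≠ 0 := by linarith
  have e : β⁻¹ * (1 - β⁻¹)⁻¹ = 1 / (β - 1) := by
    rw [← mul_inv, mul_sub, mul_inv_cancel₀ h0]
    simp
  rw [e] at h
  refine h.congr_fun fun k => ?_
  rw [pow_succ, mul_inv, mul_comm, inv_pow]

theorem IsBetaExpansion.mem_Icc {β x : ℝ} (hβ : 1 < β) {a : ℕ → Fin 2}
    (h : IsBetaExpansion β x a) : x ∈ Set.Icc 0 (1 / (β - 1)) := by
  have hp : ∀ k : ℕ, 0 ≤ (β ^ (k + 1))⁻¹ := fun k => by positivity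
  refine ⟨h.nonneg fun k => mul_nonneg (by positivity) (hp k), ?_⟩
  refine hasSum_le (fun k => ?_) h (hasSum_inv_pow_succ hβ)
  have : ((a k : ℕ) : ℝ) ≤ 1 := by exact_mod_cast Nat.lt_succ_iff.1 (a k).2
  exact mul_le_of_le_one_left (hp k) this

/-- The remainders of the greedy expansion. -/
noncomputable def greedyRemainder (β x : ℝ) : ℕ → ℝ
  | 0 => x
  | n + 1 => if 1 ≤ β * greedyRemainder β x n then β * greedyRemainder β x n - 1
      else β * greedyRemainder β x n

theorem exists_isBetaExpansion {β x : ℝ} (hβ : 1 < β) (hβ2 : β < 2)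
    (hx : x ∈ Set.Icc 0 (1 / (β - 1))) : ∃ a, IsBetaExpansion β x a := by
  have hL : 1 ≤ 1 / (β - 1) := by
    rw [le_div_iff₀ (by linarith)]; linarith
  have hLβ : β * (1 / (β - 1)) - 1 = 1 / (β - 1) := by
    have : β - 1 ≠ 0 := by linarith
    field_simp; ring
  set L := 1 / (β - 1)
  set r := greedyRemainder β x with hr
  have hr' : ∀ n, r n ∈ Set.Icc 0 L := by
    intro n
    induction n with
    | zero => exact hx
    | succ n ih =>
      have h1 : β * r n ≤ β * L := mul_le_mul_of_nonneg_left ih.2 (by linarith)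
      have h2 : 0 ≤ β * r n := mul_nonneg (by linarith) ih.1
      simp only [hr, greedyRemainder]
      rw [← hr]
      split_ifs with h <;> constructor <;> linarith
  let a : ℕ → Fin 2 := fun n => if 1 ≤ β * r n then 1 else 0
  have hstep : ∀ n, r (n + 1) = β * r n - ((a n : ℕ) : ℝ) := by
    intro n
    simp only [hr, greedyRemainder, a]
    rw [← hr]
    split_ifs with h <;> simp
  have hpart : ∀ n, ∑ k ∈ Finset.range n, ((a k : ℕ) : ℝ) * (β ^ (k + 1))⁻¹
      = x - r n * (β ^ n)⁻¹ := by
    intro n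
    induction n with
    | zero => simp [hr, greedyRemainder]
    | succ n ih =>
      rw [Finset.sum_range_succ, ih, hstep]
      have : β ≠ 0 := by positivity
      field_simp
      ring
  refine ⟨a, ?_⟩
  unfold IsBetaExpansion
  rw [hasSum_iff_tendsto_nat_of_nonneg (fun k => by positivity)]
  simp only [hpart]
  have ht : Tendsto (fun n => r n * (β ^ n)⁻¹) atTop (𝓝 0) := by
    have h0 : Tendsto (fun n => L * (β ^ n)⁻¹) atTop (𝓝 (L * 0)) :=
      (tendsto_inv_atTop_zero.comp (tendsto_pow_atTop_atTop_of_one_lt hβ)).const_mul L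
    rw [mul_zero] at h0
    refine squeeze_zero (fun n => mul_nonneg (hr' n).1 (by positivity)) (fun n => ?_) h0
    exact mul_le_mul_of_nonneg_right (hr' n).2 (by positivity)
  simpa using ht.const_sub x

theorem prefixSet_succ {β : ℝ} (hβ : 1 < β) (x : ℝ) (n : ℕ) :
    prefixSet β x (n + 1) =
      (Fin.cons (α := fun _ => Fin 2) 0) '' prefixSet β (β * x) n ∪
        (Fin.cons (α := fun _ => Fin 2) 1) '' prefixSet β (β * x - 1) n := by
  ext w
  constructor
  · rintro ⟨a, ha, haw⟩
    rw [isBetaExpansion_iff_shift hβ] at ha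
    have h0 : a 0 = w 0 := haw 0
    have hs : ∀ i : Fin n, a (i + 1) = Fin.tail w i := fun i => haw i.succ
    have hw : Fin.cons (α := fun _ => Fin 2) (w 0) (Fin.tail w) = w := Fin.cons_self_tail w
    rcases Fin.exists_fin_two.1 ⟨w 0, rfl⟩ with h | h
    · left
      refine ⟨Fin.tail w, ⟨fun k => a (k + 1), ?_, hs⟩, by rw [← h]; exact hw⟩
      rw [h0, h] at ha
      simpa using ha
    · right
      refine ⟨Fin.tail w, ⟨fun k => a (k + 1), ?_, hs⟩, by rw [← h]; exact hw⟩
      rw [h0, h] at ha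
      simpa using ha
  · have key : ∀ (d : Fin 2) (v : Fin n → Fin 2), v ∈ prefixSet β (β * x - ((d : ℕ) : ℝ)) n →
        Fin.cons (α := fun _ => Fin 2) d v ∈ prefixSet β x (n + 1) := by
      rintro d v ⟨a, ha, hav⟩
      refine ⟨fun k => Nat.casesOn k d a, ?_, ?_⟩
      · rw [isBetaExpansion_iff_shift hβ]
        exact ha
      · intro i
        refine Fin.cases rfl (fun j => ?_) i
        simpa using hav j
    rintro (⟨v, hv, rfl⟩ | ⟨v, hv, rfl⟩)
    · exact key 0 v (by simpa using hv)
    · exact key 1 v (by simpa using hv)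

theorem ncard_prefixSet_succ {β : ℝ} (hβ : 1 < β) (x : ℝ) (n : ℕ) :
    (prefixSet β x (n + 1)).ncard =
      (prefixSet β (β * x) n).ncard + (prefixSet β (β * x - 1) n).ncard := by
  rw [prefixSet_succ hβ, Set.ncard_union_eq _ (Set.toFinite _) (Set.toFinite _),
    Set.ncard_image_of_injective _ (Fin.cons_right_injective _),
    Set.ncard_image_of_injective _ (Fin.cons_right_injective _)]
  rw [Set.disjoint_left]
  rintro _ ⟨v, -, rfl⟩ ⟨u, -, h⟩
  have := congrFun h 0
  simp at this

theorem ncard_prefixSet_eq_zero {β x : ℝ} (hβ : 1 < β) (hx : x ∉ Set.Icc 0 (1 / (β - 1)))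
    (n : ℕ) : (prefixSet β x n).ncard = 0 := by
  have : prefixSet β x n = ∅ := by
    ext w
    simp only [Set.mem_empty_iff_false, iff_false]
    rintro ⟨a, ha, -⟩
    exact hx (ha.mem_Icc hβ)
  simp [this]

theorem ncard_prefixSet_zero {β x : ℝ} (hβ : 1 < β) (hβ2 : β < 2)
    (hx : x ∈ Set.Icc 0 (1 / (β - 1))) : (prefixSet β x 0).ncard = 1 := by
  obtain ⟨a, ha⟩ := exists_isBetaExpansion hβ hβ2 hx
  rw [Set.ncard_eq_one]
  refine ⟨fun i => a i, ?_⟩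
  ext w
  simp only [Set.mem_singleton_iff]
  exact ⟨fun _ => Subsingleton.elim _ _, fun _ => ⟨a, ha, fun i => i.elim0⟩⟩

/-! ### Growth rates from exponential bounds -/

theorem growthExponent_le {β x lam C : ℝ} (hlam : 0 ≤ lam) (hC : 0 < C)
    (h : ∀ n, ((prefixSet β x n).ncard : ℝ) ≤ C * lam ^ n) : growthExponent β x ≤ lam := by
  have ht : Tendsto (fun n : ℕ => C ^ (1 / (n : ℝ)) * lam) atTop (𝓝 lam) := by
    have h1 : Tendsto (fun n : ℕ => C ^ (1 / (n : ℝ))) atTop (𝓝 (C ^ (0 : ℝ))) :=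
      tendsto_const_nhds.rpow tendsto_one_div_atTop_nhds_zero_nat (Or.inl hC.ne')
    simpa using h1.mul_const lam
  rw [← ht.limsup_eq]
  refine limsup_le_limsup ?_ (prefixSet_isCoboundedUnder β x) ht.isBoundedUnder_le
  filter_upwards [eventually_gt_atTop 0] with n hn
  calc ((prefixSet β x n).ncard : ℝ) ^ (1 / (n : ℝ)) ≤ (C * lam ^ n) ^ (1 / (n : ℝ)) :=
        Real.rpow_le_rpow (by positivity) (h n) (by positivity)
    _ = C ^ (1 / (n : ℝ)) * lam := by
        rw [Real.mul_rpow hC.le (by positivity), one_div, Real.pow_rpow_inv_natCast hlam hn.ne']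

theorem le_growthExponent {β x lam : ℝ} (hlam : 0 ≤ lam) {q : ℕ} (hq : 0 < q)
    (h : ∀ k, lam ^ (q * k) ≤ ((prefixSet β x (q * k)).ncard : ℝ)) :
    lam ≤ growthExponent β x := by
  refine le_limsup_of_frequently_le ?_ (prefixSet_isBoundedUnder β x)
  rw [frequently_atTop]
  intro N
  refine ⟨q * (N + 1), by nlinarith, ?_⟩
  have hne : q * (N + 1) ≠ 0 := by positivity
  calc lam = (lam ^ (q * (N + 1))) ^ (1 / ((q * (N + 1) : ℕ) : ℝ)) := by
        rw [one_div, Real.pow_rpow_inv_natCast hlam hne]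
    _ ≤ _ := Real.rpow_le_rpow (by positivity) (h (N + 1)) (by positivity)

/-! ### Orbits staying in the open interval -/

/-- The number of words of length `n` that keep the orbit of `x` in the open interval. -/
noncomputable def interiorCount (β : ℝ) : ℕ → ℝ → ℝ
  | 0, x => Set.indicator (Set.Ioo 0 (1 / (β - 1))) 1 x
  | n + 1, x => interiorCount β n (β * x) + interiorCount β n (β * x - 1)

theorem interiorCount_nonneg (β : ℝ) (n : ℕ) (x : ℝ) : 0 ≤ interiorCount β n x := by
  induction n generalizing x with
  | zero => exact Set.indicator_nonneg (fun _ _ => zero_le_one) x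
  | succ n ih => exact add_nonneg (ih _) (ih _)

/-- Both maps expand away from the interval: an orbit that has left its interior, even to an
endpoint, never returns. -/
theorem interiorCount_eq_zero {β : ℝ} (hβ : 1 < β) {x : ℝ}
    (hx : x ∉ Set.Ioo 0 (1 / (β - 1))) (n : ℕ) : interiorCount β n x = 0 := by
  have hLβ : β * (1 / (β - 1)) - 1 = 1 / (β - 1) := by
    have : β - 1 ≠ 0 := by linarith
    field_simp; ring
  induction n generalizing x with
  | zero => exact Set.indicator_of_notMem hx _
  | succ n ih =>
    rw [interiorCount, ih, ih, add_zero]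
    all_goals
      rintro ⟨h1, h2⟩
      refine hx ⟨?_, ?_⟩
      · by_contra! h
        nlinarith
      · by_contra! h
        nlinarith

/-- An orbit reaching an endpoint has only one continuation, so a word is determined by its interior
part and its exit. This permits working in the open interval, where the strict inequalities survive
`1/(β-1) = 1 + 1/β` at `β = τ`. -/
theorem ncard_prefixSet_le_sum_interiorCount {β : ℝ} (hβ : 1 < β) (n : ℕ) (x : ℝ) :
    ((prefixSet β x n).ncard : ℝ) ≤
      2 * ∑ k ∈ Finset.range (n + 1), interiorCount β k x + 1 := by
  have hLβ : β * (1 / (β - 1)) - 1 = 1 / (β - 1) := by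
    have : β - 1 ≠ 0 := by linarith
    field_simp; ring
  have hL : 0 < 1 / (β - 1) := by
    have : 0 < β - 1 := by linarith
    positivity
  have hpos : ∀ n x, 0 ≤ ∑ k ∈ Finset.range n, interiorCount β k x := fun n x =>
    Finset.sum_nonneg fun k _ => interiorCount_nonneg β k x
  induction n generalizing x with
  | zero =>
    have h1 : (prefixSet β x 0).ncard ≤ 1 := by
      simpa using Set.ncard_le_card (prefixSet β x 0)
    have h1' : ((prefixSet β x 0).ncard : ℝ) ≤ 1 := by exact_mod_cast h1
    linarith [hpos (0 + 1) x]
  | succ n ih =>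
    have hsum : ∑ k ∈ Finset.range (n + 1 + 1), interiorCount β k x =
        ∑ k ∈ Finset.range (n + 1), interiorCount β k (β * x) +
        ∑ k ∈ Finset.range (n + 1), interiorCount β k (β * x - 1) + interiorCount β 0 x := by
      rw [Finset.sum_range_succ', ← Finset.sum_add_distrib]
      rfl
    have h0 := interiorCount_nonneg β 0 x
    by_cases hx : x ∈ Set.Ioo 0 (1 / (β - 1))
    · have h1 : interiorCount β 0 x = 1 := Set.indicator_of_mem hx _
      rw [ncard_prefixSet_succ hβ, hsum, h1]
      push_cast
      linarith [ih (β * x), ih (β * x - 1)]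
    · by_cases hx' : x ∈ Set.Icc 0 (1 / (β - 1))
      · rw [ncard_prefixSet_succ hβ, hsum]
        push_cast
        rcases Set.eq_endpoints_or_mem_Ioo_of_mem_Icc hx' with h | h | h
        · have : (prefixSet β (β * x - 1) n).ncard = 0 :=
            ncard_prefixSet_eq_zero hβ (fun h' => by rw [h] at h'; linarith [h'.1]) n
          rw [this]
          push_cast
          linarith [ih (β * x), hpos (n + 1) (β * x - 1)]
        · have : (prefixSet β (β * x) n).ncard = 0 :=
            ncard_prefixSet_eq_zero hβ (fun h' => by rw [h] at h'; linarith [h'.2]) n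
          rw [this]
          push_cast
          linarith [ih (β * x - 1), hpos (n + 1) (β * x)]
        · exact absurd h hx
      · rw [ncard_prefixSet_eq_zero hβ hx']
        push_cast
        linarith [hpos (n + 1 + 1) x]

/-! ### Upper bound: weighted pairs of orbits -/

/-- The norm on pairs of multiplicities which both `(a, b) ↦ (a, a + b)` and
`(a, b) ↦ (a + b, b)` expand by at most the golden ratio. -/
noncomputable def pairWeight (a b : ℝ) : ℝ :=
  max (Real.goldenRatio * a + b) (a + Real.goldenRatio * b)

theorem pairWeight_add_right_le {a b : ℝ} (ha : 0 ≤ a) (hb : 0 ≤ b) :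
    pairWeight a (a + b) ≤ Real.goldenRatio * pairWeight a b := by
  have h1 : Real.goldenRatio * (Real.goldenRatio * a + b) ≤ Real.goldenRatio * pairWeight a b :=
    mul_le_mul_of_nonneg_left (le_max_left _ _) Real.goldenRatio_pos.le
  have h2 := Real.goldenRatio_sq
  have h3 := Real.one_lt_goldenRatio
  refine max_le ?_ ?_ <;> nlinarith

theorem pairWeight_comm (a b : ℝ) : pairWeight a b = pairWeight b a := by
  unfold pairWeight
  rw [max_comm, add_comm a, add_comm _ b]

theorem pairWeight_add_left_le {a b : ℝ} (ha : 0 ≤ a) (hb : 0 ≤ b) :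
    pairWeight (a + b) b ≤ Real.goldenRatio * pairWeight a b := by
  rw [pairWeight_comm, pairWeight_comm a b, add_comm]
  exact pairWeight_add_right_le hb ha

theorem add_le_pairWeight (a b : ℝ) :
    Real.goldenRatio ^ 2 * (a + b) ≤ 2 * pairWeight a b := by
  have h1 : Real.goldenRatio * a + b ≤ pairWeight a b := le_max_left _ _
  have h2 : a + Real.goldenRatio * b ≤ pairWeight a b := le_max_right _ _
  rw [Real.goldenRatio_sq]
  linarith

theorem pairWeight_one_one : pairWeight 1 1 = Real.goldenRatio ^ 2 := by
  rw [pairWeight, Real.goldenRatio_sq]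
  simp [add_comm]

/-- The partial sums `β⁻¹ + ⋯ + β⁻ᵏ`. -/
noncomputable def gap (β : ℝ) : ℕ → ℝ
  | 0 => 0
  | k + 1 => (1 + gap β k) / β

theorem gap_nonneg {β : ℝ} (hβ : 1 < β) (k : ℕ) : 0 ≤ gap β k := by
  induction k with
  | zero => exact le_rfl
  | succ k ih =>
    rw [gap]
    positivity

theorem gap_mul_pow {β : ℝ} (hβ : 1 < β) (k : ℕ) :
    gap β k * β ^ k = ∑ i ∈ Finset.range k, β ^ i := by
  induction k with
  | zero => simp [gap]
  | succ k ih =>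
    have : β ≠ 0 := by positivity
    rw [Finset.sum_range_succ, ← ih, gap]
    field_simp
    ring

/-- The bounds for points and pairs feed each other, so they are proved jointly. The factor `lam ^
(m - k)` is the growth allowance saved up during the `m - k` forced steps since the distance was
`gap β m = 1`. -/
theorem interiorCount_le {β lam : ℝ} {m : ℕ} (hm : 2 ≤ m) (hβ2 : β < 2)
    (hβτ : Real.goldenRatio ≤ β) (hgap : gap β m = 1) (hlam : 1 < lam)
    (hlam2 : lam ≤ 2) (h1 : Real.goldenRatio ≤ lam ^ m) (h2 : 2 ≤ lam ^ (m + 1)) (n : ℕ) :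
    (∀ x, interiorCount β n x ≤ Real.goldenRatio ^ 2 / lam * lam ^ n) ∧
    ∀ k, 1 ≤ k → k ≤ m → ∀ p a b : ℝ, 0 ≤ a → 0 ≤ b →
      p ∈ Set.Ioo 0 (1 / (β - 1)) → p - gap β k ∈ Set.Ioo 0 (1 / (β - 1)) →
      a * interiorCount β n p + b * interiorCount β n (p - gap β k) ≤
        lam ^ (m - k) * pairWeight a b * lam ^ n := by
  have hτ := Real.goldenRatio_sq
  have hτ1 := Real.one_lt_goldenRatio
  have hβ : 1 < β := by linarith
  have hβsq : β + 1 ≤ β ^ 2 := by nlinarith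
  have hLβ : β * (1 / (β - 1)) - 1 = 1 / (β - 1) := by
    have : β - 1 ≠ 0 := by linarith
    field_simp; ring
  have hL2 : 1 / (β - 1) ≤ 2 := by
    rw [div_le_iff₀ (by linarith)]; nlinarith
  have hzero : ∀ {n : ℕ} {x : ℝ}, x ∉ Set.Ioo 0 (1 / (β - 1)) → interiorCount β n x = 0 :=
    fun h => interiorCount_eq_zero hβ h _
  have hLg : 1 / (β - 1) ≤ 1 + 1 / β := by
    rw [div_le_iff₀ (by linarith)]
    have : (1 + 1 / β) * (β - 1) = (β ^ 2 - 1) / β := by field_simp; ring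
    rw [this, le_div_iff₀ (by linarith)]
    linarith
  set L := 1 / (β - 1)
  have hpw : ∀ {a b : ℝ}, 0 ≤ a → 0 ≤ b → a + b ≤ pairWeight a b := fun ha hb =>
    le_trans (by nlinarith) (le_max_left _ _)
  have hgap1 : β * gap β 1 = 1 := by
    have : β ≠ 0 := by positivity
    simp only [gap]
    field_simp
    ring
  induction n with
  | zero =>
    have hle : ∀ x, interiorCount β 0 x ≤ 1 := fun x =>
      Set.indicator_le_self' (fun _ _ => zero_le_one) x
    constructor
    · intro x
      refine (hle x).trans ?_
      rw [pow_zero, mul_one, le_div_iff₀ (by linarith), one_mul]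
      linarith
    · intro k _ _ p a b ha hb _ _
      have h3 : 1 ≤ lam ^ (m - k) := one_le_pow₀ hlam.le
      have h4 := hpw ha hb
      have h5 := mul_le_mul_of_nonneg_left (hle p) ha
      have h6 := mul_le_mul_of_nonneg_left (hle (p - gap β k)) hb
      rw [pow_zero, mul_one]
      nlinarith
  | succ n ih =>
    obtain ⟨ihS, ihD⟩ := ih
    have hlam0 : 0 < lam := by linarith
    have hpown : 0 < lam ^ n := by positivity
    have hcone : 0 ≤ Real.goldenRatio ^ 2 / lam * lam ^ n := by positivity
    have hgrow : Real.goldenRatio ^ 2 / lam * lam ^ n ≤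
        Real.goldenRatio ^ 2 / lam * lam ^ (n + 1) := by
      rw [pow_succ lam n, ← mul_assoc]
      exact le_mul_of_one_le_right hcone hlam.le
    have hgapge : ∀ j, 1 ≤ j → 1 / β ≤ gap β j := by
      intro j hj
      obtain ⟨i, rfl⟩ := Nat.exists_eq_add_of_le' hj
      rw [gap]
      have := gap_nonneg hβ i
      gcongr
      linarith
    constructor
    · intro x
      rw [interiorCount]
      by_cases hA : β * x ∈ Set.Ioo 0 L
      · by_cases hB : β * x - 1 ∈ Set.Ioo 0 L
        · have h := ihD m (by omega) le_rfl (β * x) 1 1 zero_le_one zero_le_one hA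
            (by rwa [hgap])
          rw [hgap, pairWeight_one_one, Nat.sub_self, pow_zero] at h
          have e : Real.goldenRatio ^ 2 / lam * lam ^ (n + 1) =
              Real.goldenRatio ^ 2 * lam ^ n := by
            field_simp
            ring
          rw [e]
          linarith
        · rw [hzero hB]
          linarith [ihS (β * x)]
      · rw [hzero hA]
        linarith [ihS (β * x - 1)]
    · intro k hk1 hkm p a b ha hb hp hq
      have hab := hpw ha hb
      have hpw0 : 0 ≤ pairWeight a b := by linarith
      rw [interiorCount, interiorCount]
      have hpL : β * p - 1 < L := by nlinarith [hp.2]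
      have hq0 : 0 < β * (p - gap β k) := mul_pos (by linarith) hq.1
      rcases Nat.lt_or_ge 1 k with hk | hk
      · obtain ⟨j, rfl⟩ := Nat.exists_eq_add_of_le' hk1
        have hj : 1 ≤ j := by omega
        have hgj := hgapge j hj
        have e : β * (p - gap β (j + 1)) = β * p - 1 - gap β j := by
          have : β ≠ 0 := by positivity
          rw [gap]
          field_simp
          ring
        have hgj0 := gap_nonneg hβ j
        rw [e] at hq0 ⊢
        -- Digits are forced to 1 for the upper point and 0 for the lower one, since `L ≤ 1 + 1 / β
        -- ≤ 1 + gap β j`.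
        rw [hzero (x := β * p) (fun h => by linarith [h.2]),
          hzero (x := β * p - 1 - gap β j - 1) (fun h => by linarith [h.1])]
        have h := ihD j hj (by omega) (β * p - 1) a b ha hb ⟨by linarith, hpL⟩
          ⟨hq0, by linarith⟩
        have e2 : lam ^ (m - j) = lam ^ (m - (j + 1)) * lam := by
          rw [← pow_succ]
          congr 1
          omega
        rw [e2] at h
        rw [pow_succ]
        linarith
      · obtain rfl : k = 1 := by omega
        have e : β * (p - gap β 1) = β * p - 1 := by rw [mul_sub, hgap1]
        rw [e] at hq0 ⊢
        have e2 : lam ^ (m - 1) * pairWeight a b * lam ^ (n + 1) =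
            lam ^ m * pairWeight a b * lam ^ n := by
          obtain ⟨i, rfl⟩ := Nat.exists_eq_add_of_le' hm
          rw [show i + 2 - 1 = i + 1 by omega]
          ring
        have e3 : Real.goldenRatio * pairWeight a b * lam ^ n ≤
            lam ^ m * pairWeight a b * lam ^ n := by gcongr
        have hmid : β * p - 1 ∈ Set.Ioo 0 L := ⟨hq0, hpL⟩
        rw [e2]
        -- The common child `β * p - 1` carries `a + b`. Its neighbours are 2 apart and `L ≤ 2`, so
        -- at most one of them is interior.
        by_cases hA : β * p ∈ Set.Ioo 0 L
        · rw [hzero (x := β * p - 1 - 1) (fun h => by linarith [h.1, hA.2])]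
          have h := ihD m (by omega) le_rfl (β * p) a (a + b) ha (by linarith) hA
            (by rwa [hgap])
          rw [hgap, Nat.sub_self, pow_zero, one_mul] at h
          have h' := mul_le_mul_of_nonneg_right (pairWeight_add_right_le ha hb) hpown.le
          linarith
        · rw [hzero hA]
          by_cases hB : β * p - 1 - 1 ∈ Set.Ioo 0 L
          · have h := ihD m (by omega) le_rfl (β * p - 1) (a + b) b (by linarith) hb hmid
              (by rwa [hgap])
            rw [hgap, Nat.sub_self, pow_zero, one_mul] at h
            have h' := mul_le_mul_of_nonneg_right (pairWeight_add_left_le ha hb) hpown.le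
            linarith
          · rw [hzero hB]
            -- Collapse to one point: the only place where `2 ≤ lam ^ (m + 1)` is needed.
            have h := mul_le_mul_of_nonneg_left (ihS (β * p - 1)) (add_nonneg ha hb)
            have h3 : (a + b) * (Real.goldenRatio ^ 2 / lam) ≤ lam ^ m * pairWeight a b := by
              rw [← mul_div_assoc, div_le_iff₀ hlam0]
              have h4 := add_le_pairWeight a b
              have h5 := mul_le_mul_of_nonneg_right h2 hpw0
              rw [pow_succ] at h5
              linarith
            have h6 := mul_le_mul_of_nonneg_right h3 hpown.le
            linarith

theorem growthExponent_le_of_gap_eq_one {β lam : ℝ} {m : ℕ} (hm : 2 ≤ m) (hβ2 : β < 2)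
    (hβτ : Real.goldenRatio ≤ β) (hgap : gap β m = 1) (hlam : 1 < lam)
    (hlam2 : lam ≤ 2) (h1 : Real.goldenRatio ≤ lam ^ m) (h2 : 2 ≤ lam ^ (m + 1)) (x : ℝ) :
    growthExponent β x ≤ lam := by
  have hβ : 1 < β := Real.one_lt_goldenRatio.trans_le hβτ
  set c := Real.goldenRatio ^ 2 / lam with hc
  have hc0 : 0 < c := by have := Real.goldenRatio_pos; positivity
  have hl : 0 < lam - 1 := by linarith
  refine growthExponent_le (C := 2 * (c * (lam / (lam - 1))) + 1) (by linarith)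
    (by positivity) fun n => ?_
  have hsum : ∑ k ∈ Finset.range (n + 1), interiorCount β k x ≤
      c * (lam / (lam - 1)) * lam ^ n := by
    calc ∑ k ∈ Finset.range (n + 1), interiorCount β k x
        ≤ ∑ k ∈ Finset.range (n + 1), c * lam ^ k := Finset.sum_le_sum fun k _ =>
          (interiorCount_le hm hβ2 hβτ hgap hlam hlam2 h1 h2 k).1 x
      _ = c * ((lam ^ (n + 1) - 1) / (lam - 1)) := by
          rw [← Finset.mul_sum, geom_sum_eq hlam.ne']
      _ ≤ c * (lam ^ (n + 1) / (lam - 1)) := by gcongr; linarith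
      _ = c * (lam / (lam - 1)) * lam ^ n := by ring
  have h3 := ncard_prefixSet_le_sum_interiorCount hβ n x
  have h4 : 1 ≤ lam ^ n := one_le_pow₀ hlam.le
  linarith

/-! ### Lower bounds: points with many expansions -/

theorem ncard_prefixSet_add_ge_pow_mul {β : ℝ} (hβ : 1 < β) (n k : ℕ) (x : ℝ) :
    (prefixSet β (β ^ k * x) n).ncard ≤ (prefixSet β x (n + k)).ncard := by
  induction k generalizing x with
  | zero => simp
  | succ k ih =>
    rw [← add_assoc, ncard_prefixSet_succ hβ, pow_succ, mul_assoc]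
    exact (ih _).trans (Nat.le_add_right _ _)

theorem ncard_prefixSet_add_ge_pow_mul_sub {β : ℝ} (hβ : 1 < β) (n k : ℕ) (x : ℝ) :
    (prefixSet β (β ^ k * x - ∑ i ∈ Finset.range k, β ^ i) n).ncard ≤
      (prefixSet β x (n + k)).ncard := by
  induction k generalizing x with
  | zero => simp
  | succ k ih =>
    rw [← add_assoc, ncard_prefixSet_succ hβ]
    have e : β ^ (k + 1) * x - ∑ i ∈ Finset.range (k + 1), β ^ i =
        β ^ k * (β * x - 1) - ∑ i ∈ Finset.range k, β ^ i := by
      rw [Finset.sum_range_succ]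
      ring
    rw [e]
    exact (ih _).trans (Nat.le_add_left _ _)

theorem le_growthExponent_multinacci_block {β lam : ℝ} {m : ℕ} (hβ : 1 < β) (hβ2 : β < 2)
    (hroot : β ^ m = ∑ i ∈ Finset.range m, β ^ i) (hlam : 0 ≤ lam)
    (h2 : lam ^ (m + 1) = 2) :
    ∃ x ∈ Set.Icc 0 (1 / (β - 1)), lam ≤ growthExponent β x := by
  have hpow : 1 < β ^ (m + 1) := one_lt_pow₀ hβ (by omega)
  have hpow1 : 1 ≤ β ^ m := one_le_pow₀ hβ.le
  -- The point with expansion `(10ᵐ)^∞`; it returns to itself under both `10ᵐ` and `01ᵐ`.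
  set x := β ^ m / (β ^ (m + 1) - 1) with hx
  have hfix : β ^ (m + 1) * x - β ^ m = x := by
    have : β ^ (m + 1) - 1 ≠ 0 := by linarith
    rw [hx]
    field_simp
    ring
  have hmem : x ∈ Set.Icc 0 (1 / (β - 1)) := by
    constructor
    · exact div_nonneg (by linarith) (by linarith)
    · rw [hx, div_le_div_iff₀ (by linarith) (by linarith), pow_succ]
      linarith
  refine ⟨x, hmem, le_growthExponent hlam (Nat.succ_pos m) fun k => ?_⟩
  rw [pow_mul, h2]
  have key : 2 ^ k ≤ (prefixSet β x ((m + 1) * k)).ncard := by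
    induction k with
    | zero => rw [mul_zero, ncard_prefixSet_zero hβ hβ2 hmem, pow_zero]
    | succ k ih =>
      have e : (m + 1) * (k + 1) = (m + 1) * k + m + 1 := by ring
      rw [e, ncard_prefixSet_succ hβ]
      have h3 := ncard_prefixSet_add_ge_pow_mul_sub hβ ((m + 1) * k) m (β * x)
      have h4 := ncard_prefixSet_add_ge_pow_mul hβ ((m + 1) * k) m (β * x - 1)
      rw [← hroot, show β ^ m * (β * x) - β ^ m = x by rw [← mul_assoc, ← pow_succ, hfix]] at h3
      rw [show β ^ m * (β * x - 1) = x by rw [mul_sub, ← mul_assoc, ← pow_succ, mul_one, hfix]]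
        at h4
      rw [pow_succ]
      linarith
  exact_mod_cast key

theorem sqrt_goldenRatio_le_growthExponent :
    ∃ x ∈ Set.Icc 0 (1 / (Real.goldenRatio - 1)),
      √Real.goldenRatio ≤ growthExponent Real.goldenRatio x := by
  have hτ := Real.goldenRatio_sq
  have hβ := Real.one_lt_goldenRatio
  have hβ2 := Real.goldenRatio_lt_two
  set τ := Real.goldenRatio with hτdef
  have h4 : τ ^ 4 = 3 * τ + 2 := by
    rw [show τ ^ 4 = (τ ^ 2) ^ 2 by ring, hτ, add_sq, hτ]
    ring
  have hL : 1 / (τ - 1) = τ := by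
    rw [div_eq_iff (by linarith)]
    linarith
  rw [hL]
  set y := τ ^ 4 / (τ ^ 4 - 1) with hy
  have hfix : τ ^ 4 * y - τ ^ 4 = y := by
    have : τ ^ 4 - 1 ≠ 0 := by linarith
    rw [hy]
    field_simp
    ring
  have hy1 : 1 < y := by
    rw [hy, lt_div_iff₀ (by linarith)]
    linarith
  have hyτ : y < τ := by
    rw [hy, div_lt_iff₀ (by linarith)]
    nlinarith
  have hstep := fun x n => ncard_prefixSet_succ hβ x n
  -- The digit words `1100` and `1011` lead from `y` to `y`, and `0000` leads from `y - 1` to `y`.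
  -- Changing a final 0 to 1 leads to `y - 1` instead.
  have e1 : τ * (τ * (τ * (τ * y - 1) - 1)) = y := by
    linear_combination hfix + τ ^ 2 * hτ
  have e2 : τ * (τ * (τ * (τ * y - 1)) - 1) - 1 = y := by
    linear_combination hfix + (τ ^ 2 + 1) * hτ
  have e3 : τ * (τ * (τ * (τ * (y - 1)))) = y := by
    linear_combination hfix
  have hu : ∀ n, 2 * (prefixSet τ y n).ncard + (prefixSet τ (y - 1) n).ncard ≤
      (prefixSet τ y (n + 4)).ncard := by
    intro n
    rw [show n + 4 = n + 1 + 1 + 1 + 1 from rfl]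
    simp only [hstep]
    rw [e1, e2]
    omega
  have hv : ∀ n, (prefixSet τ y n).ncard + (prefixSet τ (y - 1) n).ncard ≤
      (prefixSet τ (y - 1) (n + 4)).ncard := by
    intro n
    rw [show n + 4 = n + 1 + 1 + 1 + 1 from rfl]
    simp only [hstep]
    rw [e3]
    omega
  have hLmem : ∀ {x : ℝ}, 0 ≤ x → x ≤ τ → x ∈ Set.Icc 0 (1 / (τ - 1)) := fun h h' => by
    rw [hL]; exact ⟨h, h'⟩
  -- The weights come from the eigenvector `(τ, 1)` of `[[2, 1], [1, 1]]`.
  have key : ∀ k, τ ^ (2 * k) ≤ ((prefixSet τ y (4 * k)).ncard : ℝ) ∧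
      τ ^ (2 * k) ≤ τ * ((prefixSet τ (y - 1) (4 * k)).ncard : ℝ) := by
    intro k
    induction k with
    | zero =>
      rw [mul_zero, mul_zero, ncard_prefixSet_zero hβ hβ2 (hLmem (by linarith) hyτ.le),
        ncard_prefixSet_zero hβ hβ2 (hLmem (by linarith) (by linarith))]
      constructor <;> push_cast <;> linarith
    | succ k ih =>
      obtain ⟨ih1, ih2⟩ := ih
      have hu' : 2 * ((prefixSet τ y (4 * k)).ncard : ℝ) + (prefixSet τ (y - 1) (4 * k)).ncard ≤
          (prefixSet τ y (4 * (k + 1))).ncard := by exact_mod_cast hu (4 * k)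
      have hv' : ((prefixSet τ y (4 * k)).ncard : ℝ) + (prefixSet τ (y - 1) (4 * k)).ncard ≤
          (prefixSet τ (y - 1) (4 * (k + 1))).ncard := by exact_mod_cast hv (4 * k)
      have h0 : 0 < τ := by linarith
      have hu'' := mul_le_mul_of_nonneg_left hu' h0.le
      have hv'' := mul_le_mul_of_nonneg_left hv' h0.le
      have ih1' := mul_le_mul_of_nonneg_left ih1 h0.le
      rw [show 2 * (k + 1) = 2 * k + 2 by ring, pow_add, hτ]
      constructor
      · refine le_of_mul_le_mul_left ?_ h0
        have : τ * (τ ^ (2 * k) * (τ + 1)) = 2 * (τ * τ ^ (2 * k)) + τ ^ (2 * k) := by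
          linear_combination τ ^ (2 * k) * hτ
        linarith
      · linarith
  refine ⟨y, ⟨by linarith, hyτ.le⟩, le_growthExponent (Real.sqrt_nonneg _) four_pos fun k => ?_⟩
  rw [show 4 * k = 2 * (2 * k) by ring, pow_mul, Real.sq_sqrt (by linarith),
    show 2 * (2 * k) = 4 * k by ring]
  exact (key k).1

/-! ### Multinacci numbers and the conclusion -/

theorem multinacci_pow_eq {m : ℕ} (hm : 2 ≤ m) :
    multinacci m ^ m = ∑ i ∈ Finset.range m, multinacci m ^ i :=
  (multinacci_isGreatest hm).1

theorem multinacci_pos {m : ℕ} (hm : 2 ≤ m) : 0 < multinacci m := by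
  obtain ⟨x, ⟨hx, hx'⟩, -⟩ := existsUnique_multinacci hm
  exact hx.trans_le ((multinacci_isGreatest hm).2 hx')

theorem multinacci_lt_two {m : ℕ} (hm : 2 ≤ m) : multinacci m < 2 := by
  have h := geom_sum_mul (multinacci m) m
  have hp : 0 < multinacci m ^ m := pow_pos (multinacci_pos hm) m
  rw [← multinacci_pow_eq hm] at h
  nlinarith

theorem goldenRatio_le_multinacci {m : ℕ} (hm : 2 ≤ m) : Real.goldenRatio ≤ multinacci m := by
  have h := multinacci_pow_eq hm
  have h0 := multinacci_pos hm
  obtain ⟨k, rfl⟩ := Nat.exists_eq_add_of_le' hm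
  set β := multinacci (k + 2)
  rw [Finset.sum_range_succ, Finset.sum_range_succ] at h
  have hs : 0 ≤ ∑ i ∈ Finset.range k, β ^ i := Finset.sum_nonneg fun i _ => by positivity
  have hk : 0 < β ^ k := by positivity
  have hsq : β + 1 ≤ β ^ 2 := by
    refine le_of_mul_le_mul_left ?_ hk
    have e : β ^ k * (β + 1) = β ^ k + β ^ (k + 1) := by ring
    rw [e, ← pow_add]
    linarith
  have hτ := Real.goldenRatio_sq
  have hτ1 := Real.one_lt_goldenRatio
  by_contra! hlt
  nlinarith

theorem multinacci_two : multinacci 2 = Real.goldenRatio := by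
  have h := multinacci_pow_eq (le_refl 2)
  have h1 := goldenRatio_le_multinacci (le_refl 2)
  rw [Finset.sum_range_succ, Finset.sum_range_one, pow_zero, pow_one] at h
  have hτ := Real.goldenRatio_sq
  have hτ1 := Real.one_lt_goldenRatio
  refine le_antisymm ?_ h1
  by_contra! hlt
  nlinarith

theorem gap_multinacci {m : ℕ} (hm : 2 ≤ m) : gap (multinacci m) m = 1 := by
  have hβ := Real.one_lt_goldenRatio.trans_le (goldenRatio_le_multinacci hm)
  have h := gap_mul_pow hβ m
  rw [← multinacci_pow_eq hm] at h
  exact (mul_eq_right₀ (pow_pos (multinacci_pos hm) m).ne').1 h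

theorem maximalGrowthExponent_multinacci_eq {m : ℕ} (hm : 2 ≤ m) {lam : ℝ} (hlam : 1 < lam)
    (hlam2 : lam ≤ 2) (h1 : Real.goldenRatio ≤ lam ^ m) (h2 : 2 ≤ lam ^ (m + 1))
    (hex : ∃ x ∈ Set.Icc 0 (1 / (multinacci m - 1)), lam ≤ growthExponent (multinacci m) x) :
    maximalGrowthExponent (multinacci m) = lam := by
  obtain ⟨x, hx, hxl⟩ := hex
  have : Nonempty (Set.Icc 0 (1 / (multinacci m - 1))) := ⟨⟨x, hx⟩⟩
  refine le_antisymm (ciSup_le fun z => ?_) ?_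
  · exact growthExponent_le_of_gap_eq_one hm (multinacci_lt_two hm)
      (goldenRatio_le_multinacci hm) (gap_multinacci hm) hlam hlam2 h1 h2 z
  · exact hxl.trans (le_ciSup (bddAbove_growthExponent (multinacci m)) ⟨x, hx⟩)

theorem mainTheorem6 (m : ℕ) (hm : 2 ≤ m) :
    maximalGrowthExponent (multinacci m) =
      if m = 2 then √Real.goldenRatio else (2 : ℝ) ^ (1 / ((m : ℝ) + 1)) := by
  have hτ := Real.goldenRatio_sq
  have hτ1 := Real.one_lt_goldenRatio
  have hτ2 := Real.goldenRatio_lt_two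
  have hβ := hτ1.trans_le (goldenRatio_le_multinacci hm)
  split_ifs with h
  · subst h
    have hs : √Real.goldenRatio ^ 2 = Real.goldenRatio := Real.sq_sqrt (by linarith)
    have hs1 : 1 < √Real.goldenRatio := by
      rw [Real.lt_sqrt zero_le_one]
      linarith
    refine maximalGrowthExponent_multinacci_eq le_rfl hs1 (by nlinarith) hs.ge ?_ ?_
    -- Enough for `τ * √τ ≥ 2`, because `τ ≥ 8 / 5`.
    · have h5 : 5 / 4 ≤ √Real.goldenRatio := by
        rw [Real.le_sqrt (by norm_num) (by linarith)]
        nlinarith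
      rw [pow_succ, hs]
      nlinarith
    · rw [multinacci_two]
      exact sqrt_goldenRatio_le_growthExponent
  · set lam : ℝ := (2 : ℝ) ^ (1 / ((m : ℝ) + 1)) with hlamdef
    have hpow : lam ^ (m + 1) = 2 := by
      have : 1 / ((m : ℝ) + 1) = ((m + 1 : ℕ) : ℝ)⁻¹ := by push_cast; rw [one_div]
      rw [hlamdef, this, Real.rpow_inv_natCast_pow (by norm_num) (by omega)]
    have hlam0 : 0 < lam := by positivity
    have hlam1 : 1 < lam := Real.one_lt_rpow (by norm_num) (by positivity)
    have hlam4 : lam ^ 4 ≤ 2 := by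
      rw [← hpow]
      exact pow_le_pow_right₀ hlam1.le (by omega)
    -- Then `lam ^ m = 2 / lam ≥ 5 / 3 ≥ τ`; this is where `m ≥ 3` enters.
    have hlam65 : lam ≤ 6 / 5 := by
      by_contra! hlt
      have := pow_lt_pow_left₀ hlt (by norm_num) (four_ne_zero)
      norm_num at this
      linarith
    refine maximalGrowthExponent_multinacci_eq hm hlam1 (by linarith) ?_ hpow.ge
      (le_growthExponent_multinacci_block hβ (multinacci_lt_two hm) (multinacci_pow_eq hm)
        hlam0.le hpow)
    have h5 : lam ^ m * lam = 2 := by rw [← pow_succ, hpow]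
    have h6 : Real.goldenRatio ≤ 5 / 3 := by nlinarith
    have h7 : 0 < lam ^ m := by positivity
    nlinarith
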